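/- Let $n$ be odd, $N=2^n$, and $\mathcal H_n=\mathbb C^N$ with computational basis $|0\rangle,\dots,|N-1\rangle$. Let $S=(-i\sigma^y)^{\otimes n}$, and let $\mathcal C_n(\phi,\psi)=\overline{\langle\phi|\mho|\psi\rangle}$ be the concurrence form, where $\mho|\psi\rangle=S\,\overline{|\psi\rangle}$ is the spin flip (so $\mathcal C_n(\phi,\psi)=\phi^TS\psi$). For $v\in SU(N)$ the pairwise concurrence capacity is $$\kappa_n(v)=\max\{\,|\mathcal C_n(v\phi,v\psi)|\ :\ \phi^\dagger\phi=\psi^\dagger\psi=1,\ \mathcal C_n(\phi,\psi)=0\,\}.$$ Let $J_N=(-i\sigma^y)\otimes I_{N/2}=\begin{pmatrix}0&-I\\ I&0\end{pmatrix}$ and $Sp(N/2)=\{\omega\in SU(N):\omega^TJ_N\omega=J_N\}$. Put $\iota_j=\langle N-1-j|S|j\rangle\in\{\pm1\}$ for $0\le j<N/2$, and let $F_0$ be the real orthogonal matrix $$F_0=\tfrac1{\sqrt2}\sum_{j=0}^{N/2-1}\Big(|j\rangle\langle j|+|N-1-j\rangle\langle j|+\iota_j\big(|j\rangle\langle N/2+j|-|N-1-j\rangle\langle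 N/2+j|\big)\Big).$$ A concurrence canonical decomposition (CCD) of $v\in SU(N)$ is a factorization $v=k_1\,(F_0dF_0^T)\,k_2$ with $k_1,k_2\in F_0\,Sp(N/2)\,F_0^T$ and $d=\sum_{j=0}^{N/2-1}d_j(|j\rangle\langle j|+|N/2+j\rangle\langle N/2+j|)\in SU(N)$, $\prod_jd_j=\pm1$. The reduced concurrence spectrum of $v$ is then $\tilde\lambda_c(v)=\{\lambda_j\}_{j=0}^{N/2-1}$ with $\lambda_j=d_j^2$. Claim. Every $v\in SU(N)$ has a CCD, the maximum defining $\kappa_n(v)$ is attained, and for every CCD of $v$, with reduced concurrence spectrum $\{\lambda_j\}_{j=0}^{N/2-1}$: (1) writing $z_1=\sum_{j=0}^{N-1}a_j|j\rangle$ and $z_2=\sum_{j=0}^{N-1}b_j|j\rangle$, $$\kappa_n(v)=\max\Big\{\Big|\sum_{j=0}^{N/2-1}\lambda_j\,(a_{N/2+j}b_j-a_jb_{N/2+j})\Big|\ :\ z_1^TJ_Nz_2=0,\ z_1^\dagger z_1=z_2^\dagger z_2=1\Big\},$$ where the maximum is attained; (2) $\kappa_n(v)=1$ if and only if $0$ lies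 in the convex hull of $\{\lambda_0,\dots,\lambda_{N/2-1}\}\subset\mathbb C$. -/

import Mathlib

open Matrix

noncomputable section

namespace QubitConcurrence

/-- The one-qubit matrix `-i σ^y`. -/
def negISigmaY : Matrix (Fin 2) (Fin 2) ℂ :=
  (-Complex.I) • !![0, -Complex.I; Complex.I, 0]

/-- The matrix `(-i σ^y)^{⊗ n}` in the computational basis `|0⟩, …, |2^n - 1⟩`: its `(j, k)` entry
is the product over all qubits of the entries of `-i σ^y` at the binary digits of `j` and `k`
(the order of the digits does not matter, since all tensor factors are equal). -/
def flipMatrix (n : ℕ) : Matrix (Fin (2 ^ n)) (Fin (2 ^ n)) ℂ :=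
  fun j k => ∏ i : Fin n, negISigmaY (finFunctionFinEquiv.symm j i) (finFunctionFinEquiv.symm k i)

/-- The (antilinear) spin flip `℧ |ψ⟩ = (-i σ^y)^{⊗ n} conj |ψ⟩`. -/
def spinFlip (n : ℕ) (ψ : Fin (2 ^ n) → ℂ) : Fin (2 ^ n) → ℂ :=
  flipMatrix n *ᵥ star ψ

/-- The concurrence bilinear form `C_n(φ, ψ) = conj ⟨φ| ℧ |ψ⟩`. -/
def concurrenceForm (n : ℕ) (φ ψ : Fin (2 ^ n) → ℂ) : ℂ :=
  star (star φ ⬝ᵥ spinFlip n ψ)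

/-- The values `|C_n(v φ, v ψ)|` over all unit vectors `φ`, `ψ` with `C_n(φ, ψ) = 0`. -/
def capacityValues (n : ℕ) (v : Matrix (Fin (2 ^ n)) (Fin (2 ^ n)) ℂ) : Set ℝ :=
  {c | ∃ φ ψ : Fin (2 ^ n) → ℂ, star φ ⬝ᵥ φ = 1 ∧ star ψ ⬝ᵥ ψ = 1 ∧
    concurrenceForm n φ ψ = 0 ∧ c = ‖concurrenceForm n (v *ᵥ φ) (v *ᵥ ψ)‖}

/-- The pairwise concurrence capacity `κ_n(v)`. -/
def pairwiseCapacity (n : ℕ) (v : Matrix (Fin (2 ^ n)) (Fin (2 ^ n)) ℂ) : ℝ :=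
  sSup (capacityValues n v)

/-- The index `j` in the first half of `{0, …, N - 1}`. -/
def lo {N : ℕ} (j : Fin (N / 2)) : Fin N := ⟨j, by omega⟩

/-- The index `N/2 + j` in the second half of `{0, …, N - 1}`. -/
def hi {N : ℕ} (j : Fin (N / 2)) : Fin N := ⟨N / 2 + j, by omega⟩

/-- For even `N`, the matrix `J_N = (-i σ^y) ⊗ I_{N/2}`, in blocks `[[0, -I], [I, 0]]`. -/
def symplecticJ (N : ℕ) : Matrix (Fin N) (Fin N) ℂ :=
  ∑ j : Fin (N / 2), (single (hi j) (lo j) 1 - single (lo j) (hi j) 1)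

/-- The group `Sp(N/2)`: the elements of `SU(N)` that preserve the two-form of `J_N`. -/
def unitarySymplectic (N : ℕ) : Set (Matrix (Fin N) (Fin N) ℂ) :=
  {ω | ω ∈ specialUnitaryGroup (Fin N) ℂ ∧ ωᵀ * symplecticJ N * ω = symplecticJ N}

/-- The diagonal matrix `∑_j d_j (|j⟩⟨j| + |N/2+j⟩⟨N/2+j|)`. -/
def repeatDiagonal {N : ℕ} (d : Fin (N / 2) → ℂ) : Matrix (Fin N) (Fin N) ℂ :=
  ∑ j : Fin (N / 2), d j • (single (lo j) (lo j) 1 + single (hi j) (hi j) 1)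

/-- The sign `ι_j`, the entry of `(-i σ^y)^{⊗ n}` at `(N-1-j, j)`. -/
def flipSign (n : ℕ) (j : Fin (2 ^ n / 2)) : ℂ :=
  flipMatrix n (Fin.rev (lo j)) (lo j)

/-- The real orthogonal matrix `F_0` whose columns are the GHZ-like vectors
`(|j⟩ + |N-1-j⟩)/√2` (column `j`) and `ι_j (|j⟩ - |N-1-j⟩)/√2` (column `N/2+j`). -/
def ghzMatrix (n : ℕ) : Matrix (Fin (2 ^ n)) (Fin (2 ^ n)) ℂ :=
  ((1 / Real.sqrt 2 : ℝ) : ℂ) • ∑ j : Fin (2 ^ n / 2),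
    (single (lo j) (lo j) 1 + single (Fin.rev (lo j)) (lo j) 1
      + flipSign n j • (single (lo j) (hi j) 1 - single (Fin.rev (lo j)) (hi j) 1))

/-- For odd `n`: `v = k₁ a k₂` is a concurrence canonical decomposition of `v`, where
`k₁, k₂ ∈ K = F_0 Sp(N/2) F_0^T` and `a = F_0 d F_0^T`, the matrix `d` being the repeated diagonal
matrix in `SU(N)` with entries `d_j` whose product is `±1`. -/
def IsOddCCD (n : ℕ) (v k₁ : Matrix (Fin (2 ^ n)) (Fin (2 ^ n)) ℂ) (d : Fin (2 ^ n / 2) → ℂ)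
    (k₂ : Matrix (Fin (2 ^ n)) (Fin (2 ^ n)) ℂ) : Prop :=
  (∃ ω₁ ∈ unitarySymplectic (2 ^ n), k₁ = ghzMatrix n * ω₁ * (ghzMatrix n)ᵀ) ∧
  (∃ ω₂ ∈ unitarySymplectic (2 ^ n), k₂ = ghzMatrix n * ω₂ * (ghzMatrix n)ᵀ) ∧
  repeatDiagonal d ∈ specialUnitaryGroup (Fin (2 ^ n)) ℂ ∧
  (∏ j, d j = 1 ∨ ∏ j, d j = -1) ∧
  v = k₁ * (ghzMatrix n * repeatDiagonal d * (ghzMatrix n)ᵀ) * k₂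

/-- For odd `n`: the family `lam = (λ_j)`, `0 ≤ j < N/2`, is the reduced concurrence spectrum of
`v`, i.e. `λ_j = d_j ^ 2` for a concurrence canonical decomposition of `v`. -/
def IsReducedConcurrenceSpectrum (n : ℕ) (v : Matrix (Fin (2 ^ n)) (Fin (2 ^ n)) ℂ)
    (lam : Fin (2 ^ n / 2) → ℂ) : Prop :=
  ∃ k₁ d k₂, IsOddCCD n v k₁ d k₂ ∧ ∀ j, lam j = d j ^ 2

end QubitConcurrence

end

open QubitConcurrence

/-!
For odd `n` the spin-flip matrix `S = (-i σ^y)^{⊗ n}` is real and antisymmetric, and it couples the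
index `j` only with `N - 1 - j`. In the GHZ basis, the columns of `F₀`, it becomes `-J`
(`ghzMatrix_transpose_mul_flipMatrix_mul`), so the theorem is about `Sp(N/2) ⊆ SU(N)`.

Existence of a decomposition (`exists_cartan_decomposition`). The antiunitary map `x ↦ J x̄` has
square `-1`. For `u ∈ SU(N)` the unitary matrix `M = J⁻¹ uᵀ J u` satisfies `J⁻¹ Mᵀ J = M`, so that
with every eigenvector `x` it has the eigenvector `J x̄`, for the same eigenvalue, and `J x̄` is
orthogonal to `x` (Kramers degeneracy). Splitting off such pairs one at a time diagonalizes `M` by a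
unitary symplectic matrix (`exists_kramers_diagonalization`); a square root `d` of the diagonal
matrix gives `u = ω₁ d ω₂`. The same diagonalization, applied to a unitary symplectic matrix itself,
whose eigenvalues are paired with their conjugates, shows that its determinant is `1`
(`det_eq_one_of_unitary_symplectic`). This replaces Pfaffians in both places where they usually
enter: `ω₁, ω₂ ∈ SU(N)` and `∏ d_j = ±1`.

The formula for the capacity (`capacityValues_eq_canonicalValues`). For `v = k₁ a k₂` the unitary
change of variables `z = F₀ᵀ k₂ φ` turns `C_n(φ, ψ)` into `-z₁ᵀ J z₂` and `C_n(vφ, vψ)` into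
`-z₁ᵀ d J d z₂`, so the two sets of values agree; compactness gives the maximum.

The value `1` (`one_mem_canonicalValues_iff`). Let `w_j = a_{N/2+j} b_j - a_j b_{N/2+j}`. Then
`∑ |w_j| ≤ 1` and `|λ_j| = 1`, so `|∑ λ_j w_j| ≤ 1`, and equality forces `λ_j w_j` to have a common
phase. The condition `∑ w_j = 0` then reads `∑ |w_j| λ_j = 0`, a convex combination. Conversely,
weights `t_j` with `∑ t_j λ_j = 0` are realized by `w_j = t_j λ̄_j`.
-/

open Matrix
open QubitConcurrence

namespace QubitConcurrence

/-! ### The two halves of the index set and the standard symplectic form -/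

variable {N : ℕ}

lemma lo_injective : Function.Injective (lo : Fin (N / 2) → Fin N) := by
  intro i j h
  simpa [lo, Fin.ext_iff] using h

lemma hi_injective : Function.Injective (hi : Fin (N / 2) → Fin N) := by
  intro i j h
  simpa [hi, Fin.ext_iff] using h

@[simp] lemma lo_inj {i j : Fin (N / 2)} : (lo i : Fin N) = lo j ↔ i = j := lo_injective.eq_iff

@[simp] lemma hi_inj {i j : Fin (N / 2)} : (hi i : Fin N) = hi j ↔ i = j := hi_injective.eq_iff

@[simp] lemma lo_ne_hi (i j : Fin (N / 2)) : (lo i : Fin N) ≠ hi j := by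
  simp only [lo, hi, ne_eq, Fin.ext_iff]
  omega

@[simp] lemma hi_ne_lo (i j : Fin (N / 2)) : (hi i : Fin N) ≠ lo j := (lo_ne_hi j i).symm

@[simp] lemma lo_ne_rev_lo (i j : Fin (N / 2)) : (lo i : Fin N) ≠ Fin.rev (lo j) := by
  simp only [lo, ne_eq, Fin.ext_iff, Fin.val_rev]
  omega

@[simp] lemma rev_lo_ne_lo (i j : Fin (N / 2)) : Fin.rev (lo i : Fin N) ≠ lo j :=
  (lo_ne_rev_lo j i).symm

lemma bijective_lo_hi (hN : Even N) :
    Function.Bijective (Sum.elim lo hi : Fin (N / 2) ⊕ Fin (N / 2) → Fin N) := by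
  rw [Fintype.bijective_iff_injective_and_card]
  refine ⟨lo_injective.sumElim hi_injective lo_ne_hi, ?_⟩
  obtain ⟨m, rfl⟩ := hN
  simp
  omega

lemma bijective_lo_rev (hN : Even N) :
    Function.Bijective
      (Sum.elim lo (fun j => Fin.rev (lo j)) : Fin (N / 2) ⊕ Fin (N / 2) → Fin N) := by
  rw [Fintype.bijective_iff_injective_and_card]
  refine ⟨lo_injective.sumElim (Fin.rev_injective.comp lo_injective) lo_ne_rev_lo, ?_⟩
  obtain ⟨m, rfl⟩ := hN
  simp
  omega

lemma forall_lo_hi (hN : Even N) {P : Fin N → Prop} (hlo : ∀ j, P (lo j)) (hhi : ∀ j, P (hi j))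
    (p : Fin N) : P p := by
  obtain ⟨q | q, rfl⟩ := (bijective_lo_hi hN).2 p
  exacts [hlo q, hhi q]

lemma forall_lo_rev (hN : Even N) {P : Fin N → Prop} (hlo : ∀ j, P (lo j))
    (hrev : ∀ j, P (Fin.rev (lo j))) (p : Fin N) : P p := by
  obtain ⟨q | q, rfl⟩ := (bijective_lo_rev hN).2 p
  exacts [hlo q, hrev q]

lemma sum_lo_hi {M : Type*} [AddCommMonoid M] (hN : Even N) (f : Fin N → M) :
    ∑ p, f p = ∑ j : Fin (N / 2), f (lo j) + ∑ j : Fin (N / 2), f (hi j) := by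
  rw [← (Equiv.ofBijective _ (bijective_lo_hi hN)).sum_comp, Fintype.sum_sum_type]
  rfl

lemma sum_lo_rev {M : Type*} [AddCommMonoid M] (hN : Even N) (f : Fin N → M) :
    ∑ p, f p = ∑ j : Fin (N / 2), f (lo j) + ∑ j : Fin (N / 2), f (Fin.rev (lo j)) := by
  rw [← (Equiv.ofBijective _ (bijective_lo_rev hN)).sum_comp, Fintype.sum_sum_type]
  rfl

/-- The function on `{0, …, N - 1}` that is `f` on the first half and `g` on the second half. -/
noncomputable def halves {α : Type*} (hN : Even N) (f g : Fin (N / 2) → α) : Fin N → α :=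
  fun p => Sum.elim f g ((Equiv.ofBijective _ (bijective_lo_hi hN)).symm p)

@[simp] lemma halves_lo {α : Type*} (hN : Even N) (f g : Fin (N / 2) → α) (j : Fin (N / 2)) :
    halves hN f g (lo j) = f j := by
  have : (Equiv.ofBijective _ (bijective_lo_hi hN)).symm (lo j) = Sum.inl j := by
    rw [Equiv.symm_apply_eq]; rfl
  simp [halves, this]

@[simp] lemma halves_hi {α : Type*} (hN : Even N) (f g : Fin (N / 2) → α) (j : Fin (N / 2)) :
    halves hN f g (hi j) = g j := by
  have : (Equiv.ofBijective _ (bijective_lo_hi hN)).symm (hi j) = Sum.inr j := by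
    rw [Equiv.symm_apply_eq]; rfl
  simp [halves, this]

lemma prod_halves {M : Type*} [CommMonoid M] (hN : Even N) (f g : Fin (N / 2) → M) :
    ∏ p, halves hN f g p = (∏ j, f j) * ∏ j, g j := by
  rw [← (Equiv.ofBijective _ (bijective_lo_hi hN)).prod_comp, Fintype.prod_sum_type]
  simp

lemma repeatDiagonal_eq (hN : Even N) (d : Fin (N / 2) → ℂ) :
    repeatDiagonal d = diagonal (halves hN d d) := by
  ext p q
  revert p q
  refine forall_lo_hi hN (fun i => forall_lo_hi hN (fun j => ?_) fun j => ?_)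
    (fun i => forall_lo_hi hN (fun j => ?_) fun j => ?_) <;>
  simp [repeatDiagonal, Matrix.sum_apply, Matrix.single_apply, diagonal_apply, ite_and]

@[simp] lemma symplecticJ_lo_lo (i j : Fin (N / 2)) : symplecticJ N (lo i) (lo j) = 0 := by
  simp [symplecticJ, Matrix.sum_apply]

@[simp] lemma symplecticJ_hi_hi (i j : Fin (N / 2)) : symplecticJ N (hi i) (hi j) = 0 := by
  simp [symplecticJ, Matrix.sum_apply]

@[simp] lemma symplecticJ_hi_lo (i j : Fin (N / 2)) :
    symplecticJ N (hi i) (lo j) = if i = j then 1 else 0 := by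
  simp [symplecticJ, Matrix.sum_apply, Matrix.single_apply, ite_and]

@[simp] lemma symplecticJ_lo_hi (i j : Fin (N / 2)) :
    symplecticJ N (lo i) (hi j) = if i = j then -1 else 0 := by
  simp [symplecticJ, Matrix.sum_apply, Matrix.single_apply, ite_and]
  split_ifs <;> simp

lemma symplecticJ_mulVec_lo (hN : Even N) (z : Fin N → ℂ) (j : Fin (N / 2)) :
    (symplecticJ N *ᵥ z) (lo j) = -z (hi j) := by
  simp [mulVec, dotProduct, sum_lo_hi hN]

lemma symplecticJ_mulVec_hi (hN : Even N) (z : Fin N → ℂ) (j : Fin (N / 2)) :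
    (symplecticJ N *ᵥ z) (hi j) = z (lo j) := by
  simp [mulVec, dotProduct, sum_lo_hi hN]

lemma symplecticJ_transpose (hN : Even N) : (symplecticJ N)ᵀ = -symplecticJ N := by
  ext p q
  revert p q
  refine forall_lo_hi hN (fun i => forall_lo_hi hN (fun j => ?_) fun j => ?_)
    (fun i => forall_lo_hi hN (fun j => ?_) fun j => ?_) <;>
  by_cases h : i = j <;> simp [h, eq_comm (a := j) (b := i)]

lemma symplecticJ_map_star : (symplecticJ N).map star = symplecticJ N := by
  ext p q
  simp only [symplecticJ, Matrix.map_apply, Matrix.sum_apply, Matrix.sub_apply,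
    Matrix.single_apply, star_sum, star_sub]
  refine Finset.sum_congr rfl fun j _ => ?_
  split_ifs <;> simp

lemma symplecticJ_mul_self (hN : Even N) : symplecticJ N * symplecticJ N = -1 := by
  ext p q
  revert p q
  refine forall_lo_hi hN (fun i => forall_lo_hi hN (fun j => ?_) fun j => ?_)
    (fun i => forall_lo_hi hN (fun j => ?_) fun j => ?_) <;>
  simp [Matrix.mul_apply, sum_lo_hi hN, Matrix.one_apply, apply_ite]

lemma symplecticJ_mul_diagonal (hN : Even N) (d : Fin (N / 2) → ℂ) :
    symplecticJ N * diagonal (halves hN d d) = diagonal (halves hN d d) * symplecticJ N := by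
  ext p q
  revert p q
  refine forall_lo_hi hN (fun i => forall_lo_hi hN (fun j => ?_) fun j => ?_)
    (fun i => forall_lo_hi hN (fun j => ?_) fun j => ?_) <;>
  by_cases h : i = j <;> simp [h]

/-! ### The spin-flip matrix and the GHZ basis -/

/-- Complementing all binary digits of `j` gives `2 ^ n - 1 - j`. -/
lemma finFunctionFinEquiv_symm_rev {n : ℕ} (j : Fin (2 ^ n)) (i : Fin n) :
    finFunctionFinEquiv.symm (Fin.rev j) i = Fin.rev (finFunctionFinEquiv.symm j i) := by
  obtain ⟨f, rfl⟩ := finFunctionFinEquiv.surjective j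
  have key : Fin.rev (finFunctionFinEquiv f) = finFunctionFinEquiv (fun i => Fin.rev (f i)) := by
    have hgeom : ∑ i : Fin n, 2 ^ (i : ℕ) = 2 ^ n - 1 := by
      rw [Fin.sum_univ_eq_sum_range (fun i => 2 ^ i), Nat.geomSum_eq le_rfl]; simp
    have hsum : ∑ i : Fin n, (Fin.rev (f i) : ℕ) * 2 ^ (i : ℕ) +
        ∑ i : Fin n, (f i : ℕ) * 2 ^ (i : ℕ) = 2 ^ n - 1 := by
      rw [← hgeom, ← Finset.sum_add_distrib]
      refine Finset.sum_congr rfl fun i _ => ?_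
      rw [← add_mul, Fin.val_rev, show 2 - ((f i : ℕ) + 1) + f i = 1 by omega, one_mul]
    ext
    rw [Fin.val_rev, finFunctionFinEquiv_apply, finFunctionFinEquiv_apply]
    omega
  rw [key]
  simp

lemma negISigmaY_eq : negISigmaY = !![0, -1; 1, 0] := by
  ext i j
  fin_cases i <;> fin_cases j <;> simp [negISigmaY]

lemma flipMatrix_map_star (n : ℕ) : (flipMatrix n).map star = flipMatrix n := by
  have h : ∀ a b, star (negISigmaY a b) = negISigmaY a b := by
    intro a b
    fin_cases a <;> fin_cases b <;> simp [negISigmaY_eq]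
  ext j k
  simp only [flipMatrix, map_apply, star_prod, h]

lemma flipMatrix_transpose {n : ℕ} (hn : Odd n) : (flipMatrix n)ᵀ = -flipMatrix n := by
  have h : ∀ a b, negISigmaY a b = -negISigmaY b a := by
    intro a b
    fin_cases a <;> fin_cases b <;> simp [negISigmaY_eq]
  ext j k
  simp only [flipMatrix, transpose_apply, Matrix.neg_apply]
  rw [Finset.prod_congr rfl fun i _ => h _ _, Finset.prod_neg]
  simp [hn.neg_one_pow]

lemma flipMatrix_eq_zero {n : ℕ} {j k : Fin (2 ^ n)} (h : j ≠ Fin.rev k) :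
    flipMatrix n j k = 0 := by
  have hne : ∃ i, finFunctionFinEquiv.symm j i = finFunctionFinEquiv.symm k i := by
    by_contra! hcon
    refine h (finFunctionFinEquiv.symm.injective (funext fun i => ?_))
    rw [finFunctionFinEquiv_symm_rev]
    have := hcon i
    generalize finFunctionFinEquiv.symm j i = a at *
    generalize finFunctionFinEquiv.symm k i = b at *
    fin_cases a <;> fin_cases b <;> simp_all
  obtain ⟨i, heq⟩ := hne
  refine Finset.prod_eq_zero (Finset.mem_univ i) ?_
  rw [heq]
  generalize finFunctionFinEquiv.symm k i = b
  fin_cases b <;> simp [negISigmaY_eq]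

lemma flipSign_mul_self {n : ℕ} (j : Fin (2 ^ n / 2)) : flipSign n j * flipSign n j = 1 := by
  rw [flipSign, flipMatrix, ← Finset.prod_mul_distrib]
  refine Finset.prod_eq_one fun i _ => ?_
  rw [finFunctionFinEquiv_symm_rev]
  generalize finFunctionFinEquiv.symm (lo j) i = b
  fin_cases b <;> simp [negISigmaY_eq]

section Ghz

variable {n : ℕ}

lemma even_two_pow (hn : Odd n) : Even (2 ^ n) := Nat.even_pow.2 ⟨even_two, hn.pos.ne'⟩

lemma flipMatrix_lo_lo (i j : Fin (2 ^ n / 2)) : flipMatrix n (lo i) (lo j) = 0 :=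
  flipMatrix_eq_zero (by simp)

lemma flipMatrix_rev_rev (i j : Fin (2 ^ n / 2)) :
    flipMatrix n (Fin.rev (lo i)) (Fin.rev (lo j)) = 0 :=
  flipMatrix_eq_zero (by simp)

lemma flipMatrix_rev_lo (i j : Fin (2 ^ n / 2)) :
    flipMatrix n (Fin.rev (lo i)) (lo j) = if i = j then flipSign n j else 0 := by
  split_ifs with h
  · rw [h, flipSign]
  · exact flipMatrix_eq_zero (by simpa using h)

lemma flipMatrix_lo_rev (hn : Odd n) (i j : Fin (2 ^ n / 2)) :
    flipMatrix n (lo i) (Fin.rev (lo j)) = if i = j then -flipSign n j else 0 := by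
  rw [← transpose_apply (flipMatrix n), flipMatrix_transpose hn, Matrix.neg_apply,
    flipMatrix_rev_lo]
  by_cases h : i = j
  · simp [h]
  · simp [h, Ne.symm h]

lemma ghzMatrix_lo_lo (i j : Fin (2 ^ n / 2)) :
    ghzMatrix n (lo i) (lo j) = if i = j then ((1 / Real.sqrt 2 : ℝ) : ℂ) else 0 := by
  simp [ghzMatrix, Matrix.sum_apply, Matrix.single_apply, ite_and]

lemma ghzMatrix_rev_lo (i j : Fin (2 ^ n / 2)) :
    ghzMatrix n (Fin.rev (lo i)) (lo j) = if i = j then ((1 / Real.sqrt 2 : ℝ) : ℂ) else 0 := by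
  simp [ghzMatrix, Matrix.sum_apply, Matrix.single_apply, ite_and]

lemma ghzMatrix_lo_hi (i j : Fin (2 ^ n / 2)) :
    ghzMatrix n (lo i) (hi j) =
      if i = j then ((1 / Real.sqrt 2 : ℝ) : ℂ) * flipSign n j else 0 := by
  by_cases h : i = j <;>
  simp [ghzMatrix, Matrix.sum_apply, Matrix.single_apply, ite_and, h]

lemma ghzMatrix_rev_hi (i j : Fin (2 ^ n / 2)) :
    ghzMatrix n (Fin.rev (lo i)) (hi j) =
      if i = j then -(((1 / Real.sqrt 2 : ℝ) : ℂ) * flipSign n j) else 0 := by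
  by_cases h : i = j <;>
  simp [ghzMatrix, Matrix.sum_apply, Matrix.single_apply, ite_and, h]

lemma invSqrtTwo_mul_self :
    ((1 / Real.sqrt 2 : ℝ) : ℂ) * ((1 / Real.sqrt 2 : ℝ) : ℂ) = 1 / 2 := by
  rw [← Complex.ofReal_mul, div_mul_div_comm, Real.mul_self_sqrt (by norm_num)]
  norm_num

lemma flipSign_star (j : Fin (2 ^ n / 2)) : star (flipSign n j) = flipSign n j :=
  congrFun (congrFun (flipMatrix_map_star n) _) _

lemma ghzMatrix_map_star (hn : Odd n) : (ghzMatrix n).map star = ghzMatrix n := by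
  have hN := even_two_pow hn
  ext p q
  revert p q
  refine forall_lo_rev hN (fun i => forall_lo_hi hN (fun j => ?_) fun j => ?_)
    (fun i => forall_lo_hi hN (fun j => ?_) fun j => ?_) <;>
  simp only [map_apply, ghzMatrix_lo_lo, ghzMatrix_rev_lo, ghzMatrix_lo_hi, ghzMatrix_rev_hi] <;>
  split_ifs <;> simp [-Complex.star_def, flipSign_star]

lemma ghzMatrix_transpose_mul_self (hn : Odd n) : (ghzMatrix n)ᵀ * ghzMatrix n = 1 := by
  have hN := even_two_pow hn
  have h2 := invSqrtTwo_mul_self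
  ext p q
  revert p q
  refine forall_lo_hi hN (fun i => forall_lo_hi hN (fun j => ?_) fun j => ?_)
    (fun i => forall_lo_hi hN (fun j => ?_) fun j => ?_) <;>
  by_cases h : i = j <;>
  simp only [Matrix.mul_apply, sum_lo_rev hN, transpose_apply, ghzMatrix_lo_lo, ghzMatrix_rev_lo,
    ghzMatrix_lo_hi, ghzMatrix_rev_hi, mul_ite, ite_mul, zero_mul, mul_zero,
    Finset.sum_ite_eq', Finset.mem_univ, if_true, Matrix.one_apply, lo_inj,
    hi_inj, lo_ne_hi, hi_ne_lo, if_false, eq_comm (a := j) (b := i), h] <;>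
  (generalize ((1 / Real.sqrt 2 : ℝ) : ℂ) = c at *)
  all_goals first | ring1 | linear_combination 2 * h2 |
    linear_combination 2 * c * c * flipSign_mul_self j + 2 * h2

/-- The spin flip is, up to sign, the standard symplectic form in the GHZ basis. -/
lemma ghzMatrix_transpose_mul_flipMatrix_mul (hn : Odd n) :
    (ghzMatrix n)ᵀ * flipMatrix n * ghzMatrix n = -symplecticJ (2 ^ n) := by
  have hN := even_two_pow hn
  have h2 := invSqrtTwo_mul_self
  ext p q
  revert p q
  refine forall_lo_hi hN (fun i => forall_lo_hi hN (fun j => ?_) fun j => ?_)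
    (fun i => forall_lo_hi hN (fun j => ?_) fun j => ?_) <;>
  by_cases h : i = j <;>
  simp only [Matrix.mul_apply, sum_lo_rev hN, transpose_apply, ghzMatrix_lo_lo, ghzMatrix_rev_lo,
    ghzMatrix_lo_hi, ghzMatrix_rev_hi, mul_ite, ite_mul, zero_mul, mul_zero,
    Finset.sum_ite_eq', Finset.mem_univ, if_true, flipMatrix_lo_lo, flipMatrix_rev_rev,
    flipMatrix_rev_lo, flipMatrix_lo_rev hn, Matrix.neg_apply, symplecticJ_lo_lo,
    symplecticJ_hi_hi, symplecticJ_lo_hi, symplecticJ_hi_lo, zero_add,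
    add_zero, if_false,
    h] <;>
  (generalize ((1 / Real.sqrt 2 : ℝ) : ℂ) = c at *)
  all_goals first | ring1 |
    linear_combination (2 * c * c) * flipSign_mul_self j + 2 * h2 |
    linear_combination -(2 * c * c) * flipSign_mul_self j - 2 * h2

end Ghz

/-! ### Kramers pairs -/

/-- The quaternionic structure `x ↦ J x̄`: an antiunitary map with square `-1`. -/
noncomputable def quatConj (x : Fin N → ℂ) : Fin N → ℂ := symplecticJ N *ᵥ star x

lemma star_quatConj (x : Fin N → ℂ) : star (quatConj x) = symplecticJ N *ᵥ x := by
  have h := congrArg (fun M : Matrix (Fin N) (Fin N) ℂ => M *ᵥ x) (symplecticJ_map_star (N := N))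
  rw [quatConj, ← h]
  ext p
  simp [mulVec, dotProduct, mul_comm]

lemma quatConj_quatConj (hN : Even N) (x : Fin N → ℂ) : quatConj (quatConj x) = -x := by
  rw [quatConj, star_quatConj, mulVec_mulVec, symplecticJ_mul_self hN, neg_mulVec, one_mulVec]

lemma quatConj_smul (c : ℂ) (x : Fin N → ℂ) : quatConj (c • x) = star c • quatConj x := by
  rw [quatConj, star_smul, mulVec_smul, quatConj]

lemma dotProduct_symplecticJ (hN : Even N) (x y : Fin N → ℂ) :
    x ⬝ᵥ symplecticJ N *ᵥ y = -(y ⬝ᵥ symplecticJ N *ᵥ x) := by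
  rw [dotProduct_mulVec, ← mulVec_transpose, symplecticJ_transpose hN, neg_mulVec, neg_dotProduct,
    dotProduct_comm]

lemma star_dotProduct_quatConj (hN : Even N) (x y : Fin N → ℂ) :
    star x ⬝ᵥ quatConj y = -(star y ⬝ᵥ quatConj x) :=
  dotProduct_symplecticJ hN _ _

lemma star_dotProduct_quatConj_self (hN : Even N) (x : Fin N → ℂ) :
    star x ⬝ᵥ quatConj x = 0 :=
  self_eq_neg.1 (star_dotProduct_quatConj hN x x)

lemma star_quatConj_dotProduct (hN : Even N) (x y : Fin N → ℂ) :
    star (quatConj x) ⬝ᵥ y = -(star (quatConj y) ⬝ᵥ x) := by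
  rw [star_quatConj, star_quatConj, dotProduct_comm, dotProduct_comm _ x,
    dotProduct_symplecticJ hN]

lemma star_quatConj_dotProduct_quatConj (hN : Even N) (x y : Fin N → ℂ) :
    star (quatConj x) ⬝ᵥ quatConj y = star y ⬝ᵥ x := by
  rw [star_quatConj_dotProduct hN, quatConj_quatConj hN, star_neg, neg_dotProduct, neg_neg]

lemma exists_unit_smul (x : Fin N → ℂ) (hx : x ≠ 0) :
    ∃ c : ℂ, star (c • x) ⬝ᵥ (c • x) = 1 := by
  have hpos : 0 < ∑ i, ‖x i‖ ^ 2 := by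
    obtain ⟨i, hxi⟩ := Function.ne_iff.1 hx
    exact Finset.sum_pos' (fun _ _ => by positivity)
      ⟨i, Finset.mem_univ i, by have := norm_pos_iff.2 hxi; positivity⟩
  have hxx : star x ⬝ᵥ x = ((∑ i, ‖x i‖ ^ 2 : ℝ) : ℂ) := by
    simp [dotProduct, Complex.conj_mul']
  refine ⟨((√(∑ i, ‖x i‖ ^ 2))⁻¹ : ℝ), ?_⟩
  rw [star_smul, smul_dotProduct, dotProduct_smul, hxx]
  simp only [Complex.star_def, Complex.conj_ofReal, smul_eq_mul]
  rw [← Complex.ofReal_mul, ← Complex.ofReal_mul, Complex.ofReal_eq_one]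
  have := Real.sqrt_pos.2 hpos
  have h2 := Real.mul_self_sqrt hpos.le
  field_simp
  linarith

/-- A unitary matrix preserves the orthogonal complement of each of its eigenvectors. -/
lemma unitary_eigenvector_orthogonal {A : Matrix (Fin N) (Fin N) ℂ}
    (hA : A ∈ unitaryGroup (Fin N) ℂ)
    {μ : ℂ} {x y : Fin N → ℂ} (hx : A *ᵥ x = μ • x) (hxy : star x ⬝ᵥ y = 0) :
    star x ⬝ᵥ A *ᵥ y = 0 := by
  have hAA : Aᴴ * A = 1 := mem_unitaryGroup_iff'.1 hA
  have h1 : star (A *ᵥ x) ⬝ᵥ A *ᵥ y = 0 := by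
    rw [star_mulVec, ← dotProduct_mulVec, mulVec_mulVec, hAA, one_mulVec, hxy]
  rw [hx, star_smul, smul_dotProduct, smul_eq_mul, mul_eq_zero] at h1
  rcases h1 with h1 | h1
  · have hx0 : x = 0 := by
      have : Aᴴ *ᵥ (A *ᵥ x) = 0 := by rw [hx, star_eq_zero.1 h1]; simp
      rwa [mulVec_mulVec, hAA, one_mulVec] at this
    simp [hx0]
  · exact h1

/-- A unitary `A` whose eigenspaces are permuted by the quaternionic structure has arbitrarily long
(up to dimension) orthonormal families of eigenvectors consisting of pairs `x`, `J x̄`. The map `σ`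
gives the eigenvalue of `J x̄` in terms of that of `x`: it is the identity or complex conjugation in
the applications. -/
lemma exists_kramers_family (hN : Even N) {A : Matrix (Fin N) (Fin N) ℂ}
    (hA : A ∈ unitaryGroup (Fin N) ℂ) {σ : ℂ → ℂ}
    (hσ : ∀ μ x, A *ᵥ x = μ • x → A *ᵥ quatConj x = σ μ • quatConj x) (m : ℕ) (hm : m ≤ N / 2) :
    ∃ (x : Fin m → Fin N → ℂ) (μ : Fin m → ℂ), (∀ i, A *ᵥ x i = μ i • x i) ∧
      (∀ i j, star (x i) ⬝ᵥ x j = if i = j then 1 else 0) ∧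
      ∀ i j, star (x i) ⬝ᵥ quatConj (x j) = 0 := by
  induction m with
  | zero => exact ⟨Fin.elim0, Fin.elim0, fun i => i.elim0, fun i => i.elim0, fun i => i.elim0⟩
  | succ m ih =>
    obtain ⟨x, μ, hx, hxx, hxT⟩ := ih (by omega)
    -- The orthogonal complement of the pairs found so far, an `A`-invariant subspace.
    let L : (Fin N → ℂ) →ₗ[ℂ] (Fin m → ℂ) × (Fin m → ℂ) :=
      (LinearMap.pi fun i => dotProductBilin ℂ ℂ (star (x i))).prod
        (LinearMap.pi fun i => dotProductBilin ℂ ℂ (star (quatConj (x i))))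
    have hL : ∀ y, y ∈ LinearMap.ker L ↔
        (∀ i, star (x i) ⬝ᵥ y = 0) ∧ ∀ i, star (quatConj (x i)) ⬝ᵥ y = 0 := by
      intro y
      rw [LinearMap.mem_ker, Prod.ext_iff, funext_iff, funext_iff]
      rfl
    have hker : LinearMap.ker L ≠ ⊥ := by
      apply LinearMap.ker_ne_bot_of_finrank_lt
      simp
      omega
    have : Nontrivial (LinearMap.ker L) := Submodule.nontrivial_iff_ne_bot.2 hker
    have hinv : ∀ y ∈ LinearMap.ker L, toLin' A y ∈ LinearMap.ker L := by
      intro y hy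
      rw [hL] at hy ⊢
      exact ⟨fun i => unitary_eigenvector_orthogonal hA (hx i) (hy.1 i),
        fun i => unitary_eigenvector_orthogonal hA (hσ _ _ (hx i)) (hy.2 i)⟩
    obtain ⟨ν, hν⟩ := Module.End.exists_eigenvalue ((toLin' A).restrict hinv)
    obtain ⟨⟨y, hyL⟩, hy⟩ := hν.exists_hasEigenvector
    have hy0 : y ≠ 0 := fun h => hy.2 (Subtype.ext h)
    have hAy : A *ᵥ y = ν • y := congrArg Subtype.val hy.apply_eq_smul
    obtain ⟨c, hc⟩ := exists_unit_smul y hy0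
    have hcL := (hL _).1 ((LinearMap.ker L).smul_mem c hyL)
    have hAcy : A *ᵥ (c • y) = ν • (c • y) := by rw [mulVec_smul, hAy, smul_comm]
    generalize c • y = w at *
    refine ⟨Fin.cons w x, Fin.cons ν μ, ?_, ?_, ?_⟩
    · refine Fin.cases ?_ fun i => ?_
      · simpa using hAcy
      · simpa using hx i
    · have h0 : ∀ i, star w ⬝ᵥ x i = 0 := fun i => by
        rw [← star_star (x i), star_dotProduct_star, hcL.1, star_zero]
      refine Fin.cases (Fin.cases ?_ fun j => ?_) fun i => Fin.cases ?_ fun j => ?_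
      · simpa using hc
      · simpa [(Fin.succ_ne_zero j).symm] using h0 j
      · simpa using hcL.1 i
      · simpa using hxx i j
    · have h0 : ∀ i, star (x i) ⬝ᵥ quatConj w = 0 := fun i => by
        rw [star_dotProduct_quatConj hN, ← star_star (quatConj (x i)), star_dotProduct_star,
          hcL.2, star_zero, neg_zero]
      refine Fin.cases (Fin.cases ?_ fun j => ?_) fun i => Fin.cases ?_ fun j => ?_
      · simpa using star_dotProduct_quatConj_self hN w
      · simpa [star_dotProduct_quatConj hN w] using h0 j
      · simpa using h0 i
      · simpa using hxT i j

/-- The full eigenbasis of Kramers pairs, as a unitary matrix commuting with the quaternionic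
structure. -/
lemma exists_kramers_diagonalization (hN : Even N) {A : Matrix (Fin N) (Fin N) ℂ}
    (hA : A ∈ unitaryGroup (Fin N) ℂ) {σ : ℂ → ℂ}
    (hσ : ∀ μ x, A *ᵥ x = μ • x → A *ᵥ quatConj x = σ μ • quatConj x) :
    ∃ ω ∈ unitaryGroup (Fin N) ℂ, ωᵀ * symplecticJ N * ω = symplecticJ N ∧
      ∃ μ : Fin (N / 2) → ℂ, A * ω = ω * diagonal (halves hN μ (σ ∘ μ)) := by
  obtain ⟨x, μ, hx, hxx, hxT⟩ := exists_kramers_family hN hA hσ (N / 2) le_rfl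
  let X : Fin N → Fin N → ℂ := halves hN x (fun j => quatConj (x j))
  have hTx : ∀ i j, star (quatConj (x i)) ⬝ᵥ x j = 0 := fun i j => by
    rw [← star_star (x j), star_dotProduct_star, hxT, star_zero]
  have hXX : ∀ p q, star (X p) ⬝ᵥ X q = if p = q then 1 else 0 := by
    refine forall_lo_hi hN (fun i => forall_lo_hi hN (fun j => ?_) fun j => ?_)
      (fun i => forall_lo_hi hN (fun j => ?_) fun j => ?_)
    · simpa [X] using hxx i j
    · simpa [X] using hxT i j
    · simpa [X] using hTx i j
    · simp [X, star_quatConj_dotProduct_quatConj hN, hxx, eq_comm]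
  have hXJ : ∀ p q, X p ⬝ᵥ symplecticJ N *ᵥ X q = symplecticJ N p q := by
    have key : ∀ p q, X p ⬝ᵥ symplecticJ N *ᵥ X q = star (quatConj (X q)) ⬝ᵥ X p := fun p q => by
      rw [star_quatConj, dotProduct_comm]
    refine forall_lo_hi hN (fun i => forall_lo_hi hN (fun j => ?_) fun j => ?_)
      (fun i => forall_lo_hi hN (fun j => ?_) fun j => ?_) <;> rw [key]
    · simpa [X] using hTx j i
    · simp [X, quatConj_quatConj hN, hxx, eq_comm (a := j) (b := i), apply_ite]
    · simp [X, star_quatConj_dotProduct_quatConj hN, hxx]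
    · simp [X, quatConj_quatConj hN, hxT]
  refine ⟨(of X)ᵀ, ?_, ?_, μ, ?_⟩
  · rw [mem_unitaryGroup_iff']
    ext p q
    simpa [Matrix.mul_apply, dotProduct, Matrix.one_apply] using hXX p q
  · ext p q
    rw [← hXJ p q, transpose_transpose, Matrix.mul_assoc, Matrix.mul_apply]
    rfl
  · ext p q
    rw [mul_diagonal]
    change (A *ᵥ X q) p = X q p * _
    revert q
    refine forall_lo_hi hN (fun j => ?_) fun j => ?_
    · simp [X, hx, mul_comm]
    · simp [X, hσ _ _ (hx j), mul_comm]

/-! ### The Cartan decomposition of `SU(N)` -/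

lemma conjTranspose_transpose_mul_transpose {ω : Matrix (Fin N) (Fin N) ℂ}
    (hω : ω ∈ unitaryGroup (Fin N) ℂ) : ωᴴᵀ * ωᵀ = 1 := by
  rw [← transpose_mul, show ω * ωᴴ = 1 from mem_unitaryGroup_iff.1 hω, transpose_one]

lemma star_conjTranspose_mulVec (A : Matrix (Fin N) (Fin N) ℂ) (x : Fin N → ℂ) :
    star (Aᴴ *ᵥ x) = Aᵀ *ᵥ star x := by
  rw [star_mulVec, conjTranspose_conjTranspose, mulVec_transpose]

open scoped ComplexOrder in
lemma unitary_conjTranspose_eigenvector {A : Matrix (Fin N) (Fin N) ℂ}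
    (hA : A ∈ unitaryGroup (Fin N) ℂ) {μ : ℂ} {x : Fin N → ℂ} (hx : A *ᵥ x = μ • x) :
    Aᴴ *ᵥ x = star μ • x := by
  have hAA : Aᴴ * A = 1 := mem_unitaryGroup_iff'.1 hA
  rcases eq_or_ne x 0 with rfl | hx0
  · simp
  have h1 : μ • (Aᴴ *ᵥ x) = x := by
    rw [← mulVec_smul, ← hx, mulVec_mulVec, hAA, one_mulVec]
  have h2 : star x ⬝ᵥ x = star μ * μ * (star x ⬝ᵥ x) := by
    have : star (A *ᵥ x) ⬝ᵥ A *ᵥ x = star x ⬝ᵥ x := by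
      rw [star_mulVec, ← dotProduct_mulVec, mulVec_mulVec, hAA, one_mulVec]
    conv_lhs => rw [← this, hx, star_smul, smul_dotProduct, dotProduct_smul]
    simp [mul_assoc]
  have h3 : star μ * μ = 1 := by
    have hne : star x ⬝ᵥ x ≠ 0 := fun h => hx0 (dotProduct_star_self_eq_zero.1 h)
    exact mul_right_cancel₀ hne (h2.symm.trans (one_mul _).symm)
  rw [← one_smul ℂ (Aᴴ *ᵥ x), ← h3, mul_smul, h1]

lemma mem_unitaryGroup_transpose {u : Matrix (Fin N) (Fin N) ℂ} (hu : u ∈ unitaryGroup (Fin N) ℂ) :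
    uᵀ ∈ unitaryGroup (Fin N) ℂ := by
  rw [mem_unitaryGroup_iff', star_eq_conjTranspose,
    show uᵀᴴ = uᴴᵀ from rfl]
  exact conjTranspose_transpose_mul_transpose hu

lemma conjTranspose_mem_unitaryGroup {u : Matrix (Fin N) (Fin N) ℂ}
    (hu : u ∈ unitaryGroup (Fin N) ℂ) : uᴴ ∈ unitaryGroup (Fin N) ℂ :=
  Unitary.star_mem hu

lemma symplecticJ_mem_unitaryGroup (hN : Even N) : symplecticJ N ∈ unitaryGroup (Fin N) ℂ := by
  have h : (symplecticJ N)ᴴ = -symplecticJ N := by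
    rw [conjTranspose, transpose_map, symplecticJ_map_star, symplecticJ_transpose hN]
  rw [mem_unitaryGroup_iff', star_eq_conjTranspose, h, neg_mul, symplecticJ_mul_self hN, neg_neg]

/-- A unitary symplectic matrix has determinant `1`: it commutes with the quaternionic structure,
so its eigenvalues come in complex conjugate pairs. -/
lemma det_eq_one_of_unitary_symplectic (hN : Even N) {ω : Matrix (Fin N) (Fin N) ℂ}
    (hω : ω ∈ unitaryGroup (Fin N) ℂ) (hJ : ωᵀ * symplecticJ N * ω = symplecticJ N) :
    ω.det = 1 := by
  -- `ω J = J ω̄`, where `ω̄` is written `ωᴴᵀ`.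
  have hcomm : ω * symplecticJ N = symplecticJ N * ωᴴᵀ := by
    have h1 : symplecticJ N * ω = ωᴴᵀ * symplecticJ N := by
      rw [← hJ, ← Matrix.mul_assoc, ← Matrix.mul_assoc,
        conjTranspose_transpose_mul_transpose hω, Matrix.one_mul, hJ]
    have h2 := congrArg (fun M => symplecticJ N * M * symplecticJ N) h1
    simp only [← Matrix.mul_assoc] at h2
    simpa [symplecticJ_mul_self hN, Matrix.mul_assoc] using h2
  have hσ : ∀ μ x, ω *ᵥ x = μ • x → ω *ᵥ quatConj x = star μ • quatConj x := fun μ x hx => by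
    rw [quatConj, mulVec_mulVec, hcomm, ← mulVec_mulVec, ← star_conjTranspose_mulVec,
      conjTranspose_conjTranspose, hx, ← quatConj, quatConj_smul, quatConj]
  obtain ⟨W, hW, -, μ, hμ⟩ := exists_kramers_diagonalization hN hω hσ
  have hWdet : W.det ≠ 0 := fun h => by
    have h0 : ‖W.det‖ = 1 := CStarRing.norm_of_mem_unitary (det_of_mem_unitary hW)
    simp [h] at h0
  -- The eigenvalues are the `μ j` and their conjugates, so the determinant is nonnegative.
  have hdet : ω.det = (‖∏ j, μ j‖ : ℂ) ^ 2 := by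
    have := congrArg det hμ
    rw [det_mul, det_mul, mul_comm, det_diagonal, prod_halves] at this
    rw [mul_left_cancel₀ hWdet this, ← Complex.mul_conj']
    simp
  have hnorm : ‖ω.det‖ = 1 := CStarRing.norm_of_mem_unitary (det_of_mem_unitary hω)
  rw [hdet] at hnorm ⊢
  have h1 : ‖∏ j, μ j‖ ^ 2 = 1 := by simpa using hnorm
  exact_mod_cast h1

/-- The Cartan decomposition of `SU(N)` with respect to `Sp(N/2)`: diagonalize
`J⁻¹ uᵀ J u = ω₂⁻¹ d² ω₂` by Kramers pairs and extract the square root `d`. -/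
lemma exists_cartan_decomposition (hN : Even N) {u : Matrix (Fin N) (Fin N) ℂ}
    (hu : u ∈ specialUnitaryGroup (Fin N) ℂ) :
    ∃ ω₁ ∈ unitarySymplectic N, ∃ ω₂ ∈ unitarySymplectic N, ∃ d : Fin (N / 2) → ℂ,
      repeatDiagonal d ∈ specialUnitaryGroup (Fin N) ℂ ∧ (∏ j, d j = 1 ∨ ∏ j, d j = -1) ∧
      u = ω₁ * repeatDiagonal d * ω₂ := by
  obtain ⟨huU, hudet⟩ := mem_specialUnitaryGroup_iff.1 hu
  have hJJ := symplecticJ_mul_self hN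
  have hJU := symplecticJ_mem_unitaryGroup hN
  set J := symplecticJ N with hJ
  obtain ⟨M, hM⟩ : ∃ M, M = -(J * uᵀ * J * u) := ⟨_, rfl⟩
  have hMU : M ∈ unitaryGroup (Fin N) ℂ := by
    have h := mul_mem (mul_mem (mul_mem hJU (mem_unitaryGroup_transpose huU)) hJU) huU
    rw [hM, mem_unitaryGroup_iff, star_neg, neg_mul_neg]
    exact mem_unitaryGroup_iff.1 h
  have hJM : J * M = uᵀ * J * u := by
    rw [hM, mul_neg, ← Matrix.mul_assoc, ← Matrix.mul_assoc, ← Matrix.mul_assoc, hJJ]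
    simp
  have hMT : J * Mᵀ = M * J := by
    simp only [hM, transpose_neg, transpose_mul, transpose_transpose]
    rw [hJ, symplecticJ_transpose hN]
    simp [Matrix.mul_assoc]
  -- `Mᵀ x̄ = μ x̄`, so `M J x̄ = J Mᵀ x̄ = μ J x̄`.
  have hσ : ∀ μ x, M *ᵥ x = μ • x → M *ᵥ quatConj x = id μ • quatConj x := fun μ x hx => by
    have h := congrArg star (unitary_conjTranspose_eigenvector hMU hx)
    rw [star_conjTranspose_mulVec, star_smul, star_star] at h
    rw [quatConj, ← hJ, mulVec_mulVec, ← hMT, ← mulVec_mulVec, h, mulVec_smul, id]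
  obtain ⟨W, hW, hWJ, μ, hμ⟩ := exists_kramers_diagonalization hN hMU hσ
  rw [← hJ] at hWJ
  have hWW : Wᴴ * W = 1 := mem_unitaryGroup_iff'.1 hW
  have hWW' : W * Wᴴ = 1 := mem_unitaryGroup_iff.1 hW
  choose d hd using fun j => IsAlgClosed.exists_pow_nat_eq (μ j) two_pos
  -- Conjugating by `W` shows that the eigenvalues `μ`, hence their square roots, are unimodular.
  have hDU : diagonal (halves hN μ μ) ∈ unitaryGroup (Fin N) ℂ := by
    have : diagonal (halves hN μ μ) = Wᴴ * (M * W) := by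
      rw [hμ, ← Matrix.mul_assoc, hWW, Matrix.one_mul]; rfl
    rw [this]
    exact mul_mem (conjTranspose_mem_unitaryGroup hW) (mul_mem hMU hW)
  have hdd : ∀ j, star (d j) * d j = 1 := fun j => by
    have h := congrFun (congrFun (mem_unitaryGroup_iff'.1 hDU) (lo j)) (lo j)
    simp only [star_eq_conjTranspose, diagonal_conjTranspose, diagonal_mul_diagonal,
      diagonal_apply_eq, Pi.star_apply, halves_lo, Matrix.one_apply_eq, ← hd] at h
    have h1 : ‖d j‖ ^ 2 = 1 := by
      have h2 : ‖d j‖ ^ 4 = 1 := by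
        have := congrArg norm h
        simp only [norm_mul, norm_star, norm_pow, norm_one] at this
        linear_combination this
      have h3 : (‖d j‖ ^ 2 - 1) * (‖d j‖ ^ 2 + 1) = 0 := by linear_combination h2
      rcases mul_eq_zero.1 h3 with h | h
      · linarith
      · nlinarith [sq_nonneg ‖d j‖]
    rw [Complex.star_def, Complex.conj_mul']
    exact_mod_cast h1
  obtain ⟨E, hE⟩ : ∃ E, E = diagonal (halves hN d d) := ⟨_, rfl⟩
  have hstar : Eᴴ = diagonal (halves hN (star d) (star d)) := by
    rw [hE, diagonal_conjTranspose]
    congr 1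
    funext p
    revert p
    exact forall_lo_hi hN (fun j => by simp) fun j => by simp
  have hEE : Eᴴ * E = 1 := by
    rw [hstar, hE, diagonal_mul_diagonal, ← diagonal_one]
    congr 1
    funext p
    revert p
    exact forall_lo_hi hN (fun j => by simpa using hdd j) fun j => by simpa using hdd j
  have hEU : E ∈ unitaryGroup (Fin N) ℂ := mem_unitaryGroup_iff'.2 hEE
  have hE2 : E * E = diagonal (halves hN μ μ) := by
    rw [hE, diagonal_mul_diagonal]
    congr 1
    funext p
    revert p
    exact forall_lo_hi hN (fun j => by simp [← hd, sq]) fun j => by simp [← hd, sq]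
  have hμ' : M * W = W * (E * E) := by rw [hE2]; exact hμ
  have hJE : J * Eᴴ = Eᴴ * J := by rw [hstar, hJ, symplecticJ_mul_diagonal]
  have hEt : Eᴴᵀ = Eᴴ := by rw [hstar, diagonal_transpose]
  have hω₁U : u * W * Eᴴ ∈ unitaryGroup (Fin N) ℂ :=
    mul_mem (mul_mem huU hW) (conjTranspose_mem_unitaryGroup hEU)
  have hω₁J : (u * W * Eᴴ)ᵀ * J * (u * W * Eᴴ) = J := calc
    (u * W * Eᴴ)ᵀ * J * (u * W * Eᴴ) = Eᴴ * (Wᵀ * (uᵀ * J * u) * W) * Eᴴ := by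
      simp only [transpose_mul, hEt, Matrix.mul_assoc]
    _ = Eᴴ * ((Wᵀ * J * W) * (E * E)) * Eᴴ := by
      rw [← hJM, Matrix.mul_assoc Wᵀ, Matrix.mul_assoc J, hμ']
      simp only [Matrix.mul_assoc]
    _ = (J * (Eᴴ * E)) * (E * Eᴴ) := by
      rw [hWJ, ← Matrix.mul_assoc Eᴴ J, ← hJE]
      simp only [Matrix.mul_assoc]
    _ = J := by rw [hEE, show E * Eᴴ = 1 from mem_unitaryGroup_iff.1 hEU]; simp
  have hω₂J : Wᴴᵀ * J * Wᴴ = J := by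
    have h := conjTranspose_transpose_mul_transpose hW
    conv_lhs => rw [← hWJ]
    simp only [← Matrix.mul_assoc]
    rw [h, Matrix.mul_assoc, hWW', Matrix.one_mul, Matrix.mul_one]
  have hω₁det := det_eq_one_of_unitary_symplectic hN hω₁U hω₁J
  have hω₂U := conjTranspose_mem_unitaryGroup hW
  have hω₂det := det_eq_one_of_unitary_symplectic hN hω₂U hω₂J
  have hfac : u = u * W * Eᴴ * E * Wᴴ := by
    rw [Matrix.mul_assoc _ Eᴴ, hEE, Matrix.mul_one, Matrix.mul_assoc, hWW', Matrix.mul_one]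
  -- No Pfaffian is needed: `det d = 1` since the other factors have determinant `1`.
  have hEdet : E.det = 1 := by
    have h := congrArg det hfac
    rw [det_mul, det_mul _ E, hω₁det, hω₂det, hudet] at h
    simpa using h.symm
  refine ⟨_, ⟨mem_specialUnitaryGroup_iff.2 ⟨hω₁U, hω₁det⟩, hω₁J⟩,
    _, ⟨mem_specialUnitaryGroup_iff.2 ⟨hω₂U, hω₂det⟩, hω₂J⟩, d, ?_, ?_, ?_⟩
  · rw [repeatDiagonal_eq hN, ← hE]
    exact mem_specialUnitaryGroup_iff.2 ⟨hEU, hEdet⟩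
  · rw [hE, det_diagonal, prod_halves] at hEdet
    exact mul_self_eq_one_iff.1 hEdet
  · rwa [repeatDiagonal_eq hN, ← hE]

/-! ### Unimodular coefficients and the convex hull -/

lemma zero_mem_convexHull_range_iff {ι : Type*} [Fintype ι] (lam : ι → ℂ) :
    (0 : ℂ) ∈ convexHull ℝ (Set.range lam) ↔
      ∃ t : ι → ℝ, (∀ i, 0 ≤ t i) ∧ ∑ i, t i = 1 ∧ ∑ i, (t i : ℂ) * lam i = 0 := by
  constructor
  · rw [convexHull_range_eq_exists_affineCombination]
    rintro ⟨s, w, hw0, hw1, hw⟩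
    rw [Finset.affineCombination_eq_linear_combination _ _ _ hw1] at hw
    classical
    refine ⟨fun i => if i ∈ s then w i else 0, fun i => ?_, ?_, ?_⟩
    · dsimp only
      split_ifs with h
      exacts [hw0 i h, le_rfl]
    · simpa using hw1
    · simpa [apply_ite, ite_mul] using hw
  · rintro ⟨t, ht0, ht1, ht⟩
    exact mem_convexHull_of_exists_fintype t lam ht0 ht1 (fun i => ⟨i, rfl⟩) (by simpa using ht)

/-- The equality case of the triangle inequality: if unimodular `λ_j` turn a vanishing sum of `w_j`
with `∑ ‖w_j‖ ≤ 1` into a sum of modulus `1`, then all `λ_j w_j` have the same phase and the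
`‖w_j‖` are the weights of a convex combination of the `λ_j` that vanishes. -/
lemma zero_mem_convexHull_of_norm_sum_eq_one {ι : Type*} [Fintype ι] {lam w : ι → ℂ}
    (hlam : ∀ i, ‖lam i‖ = 1) (hw0 : ∑ i, w i = 0) (hw1 : ∑ i, ‖w i‖ ≤ 1)
    (h : ‖∑ i, lam i * w i‖ = 1) : (0 : ℂ) ∈ convexHull ℝ (Set.range lam) := by
  set s := ∑ i, lam i * w i with hs
  have hss : star s * s = 1 := by
    rw [Complex.star_def, Complex.conj_mul', h]; simp
  have hnorm : ∀ i, ‖star s * (lam i * w i)‖ = ‖w i‖ := fun i => by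
    rw [norm_mul, norm_mul, norm_star, h, hlam, one_mul, one_mul]
  have hle : ∀ i, (star s * (lam i * w i)).re ≤ ‖w i‖ := fun i =>
    (Complex.re_le_norm _).trans (hnorm i).le
  have hsum : ∑ i, (star s * (lam i * w i)).re = 1 := by
    rw [← Complex.re_sum, ← Finset.mul_sum, ← hs, hss, Complex.one_re]
  have hone : ∑ i, ‖w i‖ = 1 :=
    le_antisymm hw1 (hsum ▸ Finset.sum_le_sum fun i _ => hle i)
  have hre : ∀ i, (star s * (lam i * w i)).re = ‖w i‖ := fun i =>
    (Finset.sum_eq_sum_iff_of_le fun i _ => hle i).1 (hsum.trans hone.symm) i (Finset.mem_univ i)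
  have hphase : ∀ i, star s * (lam i * w i) = ‖w i‖ := fun i => by
    have him : (star s * (lam i * w i)).im = 0 := by
      rw [← Complex.abs_re_eq_norm, hnorm, hre, abs_of_nonneg (norm_nonneg _)]
    exact Complex.ext (by rw [hre, Complex.ofReal_re]) (by rw [him, Complex.ofReal_im])
  refine (zero_mem_convexHull_range_iff lam).2
    ⟨fun i => ‖w i‖, fun i => norm_nonneg _, hone, ?_⟩
  have hterm : ∀ i, (‖w i‖ : ℂ) * lam i = s * star (w i) := fun i => by
    have h1 : star (‖w i‖ : ℂ) = ‖w i‖ := Complex.conj_ofReal _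
    have h2 : star (lam i) * lam i = 1 := by
      rw [Complex.star_def, Complex.conj_mul', hlam]; simp
    rw [← h1, ← hphase, star_mul', star_mul', star_star]
    linear_combination s * star (w i) * h2
  rw [Finset.sum_congr rfl fun i _ => hterm i, ← Finset.mul_sum, ← star_sum, hw0, star_zero,
    mul_zero]

/-- The set of values of the canonical form
`|∑ j, λ_j (a_{N/2+j} b_j - a_j b_{N/2+j})|` over pairs of unit vectors `a`, `b` that are
orthogonal for the symplectic form. -/
def canonicalValues {N : ℕ} (lam : Fin (N / 2) → ℂ) : Set ℝ :=
  {c : ℝ | ∃ z₁ z₂ : Fin N → ℂ,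
    z₁ ⬝ᵥ (symplecticJ N *ᵥ z₂) = 0 ∧ star z₁ ⬝ᵥ z₁ = 1 ∧ star z₂ ⬝ᵥ z₂ = 1 ∧
    c = ‖∑ j : Fin (N / 2), lam j * (z₁ (hi j) * z₂ (lo j) - z₁ (lo j) * z₂ (hi j))‖}

lemma dotProduct_symplecticJ_mulVec {N : ℕ} (hN : Even N) (z₁ z₂ : Fin N → ℂ) :
    z₁ ⬝ᵥ (symplecticJ N *ᵥ z₂) =
      ∑ j : Fin (N / 2), (z₁ (hi j) * z₂ (lo j) - z₁ (lo j) * z₂ (hi j)) := by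
  rw [dotProduct, sum_lo_hi hN, ← Finset.sum_add_distrib]
  refine Finset.sum_congr rfl fun j _ => ?_
  rw [symplecticJ_mulVec_lo hN, symplecticJ_mulVec_hi hN]
  ring

lemma star_dotProduct_self_eq_one_iff {N : ℕ} (z : Fin N → ℂ) :
    star z ⬝ᵥ z = 1 ↔ ∑ i, ‖z i‖ ^ 2 = 1 := by
  have : star z ⬝ᵥ z = ((∑ i, ‖z i‖ ^ 2 : ℝ) : ℂ) := by
    simp [dotProduct, Complex.conj_mul']
  rw [this, Complex.ofReal_eq_one]

/-- Termwise `|ad - bc| ≤ (|a|² + |b|² + |c|² + |d|²) / 2`, and the squares add up to `2`. -/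
lemma sum_norm_symplectic_le_one {N : ℕ} (hN : Even N) {z₁ z₂ : Fin N → ℂ}
    (h₁ : star z₁ ⬝ᵥ z₁ = 1) (h₂ : star z₂ ⬝ᵥ z₂ = 1) :
    ∑ j : Fin (N / 2), ‖z₁ (hi j) * z₂ (lo j) - z₁ (lo j) * z₂ (hi j)‖ ≤ 1 := by
  rw [star_dotProduct_self_eq_one_iff, sum_lo_hi hN] at h₁ h₂
  calc _ ≤ ∑ j : Fin (N / 2), (‖z₁ (lo j)‖ ^ 2 + ‖z₁ (hi j)‖ ^ 2 +
          (‖z₂ (lo j)‖ ^ 2 + ‖z₂ (hi j)‖ ^ 2)) / 2 := by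
        refine Finset.sum_le_sum fun j _ => (norm_sub_le _ _).trans ?_
        rw [norm_mul, norm_mul]
        linarith [two_mul_le_add_sq ‖z₁ (hi j)‖ ‖z₂ (lo j)‖,
          two_mul_le_add_sq ‖z₁ (lo j)‖ ‖z₂ (hi j)‖]
    _ = 1 := by
        rw [← Finset.sum_div, Finset.sum_add_distrib, Finset.sum_add_distrib,
          Finset.sum_add_distrib, h₁, h₂]
        norm_num

lemma canonicalValues_le_one {N : ℕ} (hN : Even N) {lam : Fin (N / 2) → ℂ}
    (hlam : ∀ j, ‖lam j‖ = 1) {c : ℝ} (hc : c ∈ canonicalValues lam) : c ≤ 1 := by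
  obtain ⟨z₁, z₂, -, h₁, h₂, rfl⟩ := hc
  refine (norm_sum_le _ _).trans ?_
  simpa only [norm_mul, hlam, one_mul] using sum_norm_symplectic_le_one hN h₁ h₂

lemma one_mem_canonicalValues_iff {N : ℕ} (hN : Even N) {lam : Fin (N / 2) → ℂ}
    (hlam : ∀ j, ‖lam j‖ = 1) :
    1 ∈ canonicalValues lam ↔ (0 : ℂ) ∈ convexHull ℝ (Set.range lam) := by
  constructor
  · rintro ⟨z₁, z₂, h0, h₁, h₂, h⟩
    rw [dotProduct_symplecticJ_mulVec hN] at h0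
    exact zero_mem_convexHull_of_norm_sum_eq_one hlam h0 (sum_norm_symplectic_le_one hN h₁ h₂)
      h.symm
  · rw [zero_mem_convexHull_range_iff]
    rintro ⟨t, ht0, ht1, ht⟩
    -- The pairs `(z₁ (hi j), z₂ (lo j))` are chosen with product `t_j * conj λ_j`.
    have hsq : ∀ j, (√(t j) : ℂ) * √(t j) = t j := fun j => by
      rw [← Complex.ofReal_mul, Real.mul_self_sqrt (ht0 j)]
    have hll : ∀ j, lam j * star (lam j) = 1 := fun j => by
      rw [Complex.star_def, Complex.mul_conj', hlam]; simp
    refine ⟨halves hN 0 fun j => (√(t j) : ℂ), halves hN (fun j => √(t j) * star (lam j)) 0,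
      ?_, ?_, ?_, ?_⟩
    · rw [dotProduct_symplecticJ_mulVec hN]
      have h := congrArg star ht
      simp only [star_sum, star_mul', star_zero] at h
      rw [← h]
      refine Finset.sum_congr rfl fun j _ => ?_
      have h1 : star (t j : ℂ) = t j := Complex.conj_ofReal _
      simp only [halves_lo, halves_hi, Pi.zero_apply, zero_mul, sub_zero, h1]
      rw [← mul_assoc, hsq]
    · rw [star_dotProduct_self_eq_one_iff, sum_lo_hi hN]
      simp [Real.sq_sqrt (ht0 _), ht1]
    · rw [star_dotProduct_self_eq_one_iff, sum_lo_hi hN]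
      simp [hlam, Real.sq_sqrt (ht0 _), ht1]
    · have h : ∑ j, lam j * (√(t j) * (√(t j) * star (lam j))) = (1 : ℂ) := by
        rw [← Complex.ofReal_one, ← ht1, Complex.ofReal_sum]
        refine Finset.sum_congr rfl fun j _ => ?_
        linear_combination (lam j * star (lam j)) * hsq j + t j * hll j
      simp only [halves_lo, halves_hi, Pi.zero_apply, zero_mul, sub_zero, h, norm_one]

/-! ### The concurrence form in canonical coordinates -/

variable {n : ℕ}

lemma concurrenceForm_eq (φ ψ : Fin (2 ^ n) → ℂ) :
    concurrenceForm n φ ψ = φ ⬝ᵥ flipMatrix n *ᵥ ψ := by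
  have h : star (flipMatrix n *ᵥ star ψ) = flipMatrix n *ᵥ ψ := by
    conv_rhs => rw [← flipMatrix_map_star n]
    ext p
    simp [mulVec, dotProduct, mul_comm]
  rw [concurrenceForm, spinFlip, ← star_dotProduct_star, star_star, h, dotProduct_comm]

lemma continuous_concurrenceForm {X : Type*} [TopologicalSpace X] {f g : X → Fin (2 ^ n) → ℂ}
    (hf : Continuous f) (hg : Continuous g) :
    Continuous fun x => concurrenceForm n (f x) (g x) := by
  simp only [concurrenceForm_eq]
  exact hf.dotProduct (continuous_const.matrix_mulVec hg)

lemma isCompact_capacityValues (v : Matrix (Fin (2 ^ n)) (Fin (2 ^ n)) ℂ) :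
    IsCompact (capacityValues n v) := by
  let K : Set ((Fin (2 ^ n) → ℂ) × (Fin (2 ^ n) → ℂ)) :=
    {p | star p.1 ⬝ᵥ p.1 = 1 ∧ star p.2 ⬝ᵥ p.2 = 1 ∧ concurrenceForm n p.1 p.2 = 0}
  have hK : IsCompact K := by
    refine Metric.isCompact_of_isClosed_isBounded ?_ ?_
    · exact (isClosed_eq (continuous_fst.star.dotProduct continuous_fst) continuous_const).inter
        ((isClosed_eq (continuous_snd.star.dotProduct continuous_snd) continuous_const).inter
        (isClosed_eq (continuous_concurrenceForm continuous_fst continuous_snd) continuous_const))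
    · have hb : ∀ z : Fin (2 ^ n) → ℂ, star z ⬝ᵥ z = 1 → ‖z‖ ≤ 1 := fun z hz => by
        rw [star_dotProduct_self_eq_one_iff] at hz
        refine (pi_norm_le_iff_of_nonneg zero_le_one).2 fun i => ?_
        have := Finset.single_le_sum (f := fun i => ‖z i‖ ^ 2) (fun i _ => by positivity)
          (Finset.mem_univ i)
        exact (sq_le_one_iff₀ (norm_nonneg _)).1 (hz ▸ this)
      refine isBounded_iff_forall_norm_le.2 ⟨1, fun p hp => ?_⟩
      exact max_le (hb _ hp.1) (hb _ hp.2.1)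
  have himage : capacityValues n v =
      (fun p : (Fin (2 ^ n) → ℂ) × (Fin (2 ^ n) → ℂ) =>
        ‖concurrenceForm n (v *ᵥ p.1) (v *ᵥ p.2)‖) '' K := by
    ext c
    constructor
    · rintro ⟨φ, ψ, h1, h2, h3, rfl⟩
      exact ⟨(φ, ψ), ⟨h1, h2, h3⟩, rfl⟩
    · rintro ⟨⟨φ, ψ⟩, ⟨h1, h2, h3⟩, rfl⟩
      exact ⟨φ, ψ, h1, h2, h3, rfl⟩
  rw [himage]
  exact hK.image (continuous_concurrenceForm (continuous_const.matrix_mulVec continuous_fst)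
    (continuous_const.matrix_mulVec continuous_snd)).norm

lemma nonempty_capacityValues (hn : Odd n) (v : Matrix (Fin (2 ^ n)) (Fin (2 ^ n)) ℂ) :
    (capacityValues n v).Nonempty := by
  have hz : star (Pi.single 0 1 : Fin (2 ^ n) → ℂ) ⬝ᵥ Pi.single 0 1 = 1 := by simp
  refine ⟨_, Pi.single 0 1, Pi.single 0 1, hz, hz, ?_, rfl⟩
  -- The concurrence form is alternating, the spin-flip matrix being antisymmetric.
  have h := congrFun (congrFun (flipMatrix_transpose hn) 0) 0
  rw [transpose_apply, Matrix.neg_apply] at h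
  rw [concurrenceForm_eq]
  simpa using self_eq_neg.1 h

lemma isGreatest_pairwiseCapacity (hn : Odd n) (v : Matrix (Fin (2 ^ n)) (Fin (2 ^ n)) ℂ) :
    IsGreatest (capacityValues n v) (pairwiseCapacity n v) :=
  (isCompact_capacityValues v).isGreatest_sSup (nonempty_capacityValues hn v)

lemma ghzMatrix_mul_transpose (hn : Odd n) : ghzMatrix n * (ghzMatrix n)ᵀ = 1 :=
  mul_eq_one_comm.1 (ghzMatrix_transpose_mul_self hn)

lemma ghzMatrix_mem_unitaryGroup (hn : Odd n) :
    ghzMatrix n ∈ unitaryGroup (Fin (2 ^ n)) ℂ := by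
  have h : (ghzMatrix n)ᴴ = (ghzMatrix n)ᵀ := by
    rw [conjTranspose, transpose_map, ghzMatrix_map_star hn]
  rw [mem_unitaryGroup_iff', star_eq_conjTranspose, h, ghzMatrix_transpose_mul_self hn]

/-- The Cartan decomposition of `F₀ᵀ v F₀`, transported by the GHZ matrix. -/
lemma exists_isOddCCD (hn : Odd n) {v : Matrix (Fin (2 ^ n)) (Fin (2 ^ n)) ℂ}
    (hv : v ∈ specialUnitaryGroup (Fin (2 ^ n)) ℂ) : ∃ k₁ d k₂, IsOddCCD n v k₁ d k₂ := by
  have hF := ghzMatrix_transpose_mul_self hn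
  have hF' := ghzMatrix_mul_transpose hn
  have hFU := ghzMatrix_mem_unitaryGroup hn
  obtain ⟨hvU, hvdet⟩ := mem_specialUnitaryGroup_iff.1 hv
  have hu : (ghzMatrix n)ᵀ * v * ghzMatrix n ∈ specialUnitaryGroup (Fin (2 ^ n)) ℂ := by
    refine mem_specialUnitaryGroup_iff.2
      ⟨mul_mem (mul_mem (mem_unitaryGroup_transpose hFU) hvU) hFU, ?_⟩
    rw [det_mul, det_mul, hvdet, mul_one, ← det_mul, hF, det_one]
  obtain ⟨ω₁, h₁, ω₂, h₂, d, hd, hprod, h⟩ := exists_cartan_decomposition (even_two_pow hn) hu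
  refine ⟨_, d, _, ⟨ω₁, h₁, rfl⟩, ⟨ω₂, h₂, rfl⟩, hd, hprod, ?_⟩
  calc v = ghzMatrix n * ((ghzMatrix n)ᵀ * v * ghzMatrix n) * (ghzMatrix n)ᵀ := by
        simp only [Matrix.mul_assoc, hF', Matrix.mul_one]
        rw [← Matrix.mul_assoc, hF', Matrix.one_mul]
    _ = ghzMatrix n * ω₁ * ((ghzMatrix n)ᵀ * ghzMatrix n) * repeatDiagonal d *
          ((ghzMatrix n)ᵀ * ghzMatrix n) * ω₂ * (ghzMatrix n)ᵀ := by
        rw [h, hF]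
        simp only [Matrix.mul_one, Matrix.mul_assoc]
    _ = _ := by simp only [Matrix.mul_assoc]

lemma unitary_mulVec_dotProduct {N : ℕ} {G : Matrix (Fin N) (Fin N) ℂ}
    (hG : G ∈ unitaryGroup (Fin N) ℂ) (z : Fin N → ℂ) :
    star (G *ᵥ z) ⬝ᵥ G *ᵥ z = star z ⬝ᵥ z := by
  rw [star_mulVec, ← dotProduct_mulVec, mulVec_mulVec, show Gᴴ * G = 1 from
    mem_unitaryGroup_iff'.1 hG, one_mulVec]

/-- The coordinate change `z = F₀ᵀ k₂ φ` carries the concurrence form and its pullback under `v` to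
the canonical symplectic forms, up to a common sign. -/
lemma capacityValues_eq_canonicalValues (hn : Odd n)
    {v k₁ k₂ : Matrix (Fin (2 ^ n)) (Fin (2 ^ n)) ℂ}
    {d : Fin (2 ^ n / 2) → ℂ} (h : IsOddCCD n v k₁ d k₂) :
    capacityValues n v = canonicalValues fun j => d j ^ 2 := by
  have hN := even_two_pow hn
  obtain ⟨⟨ω₁, ⟨-, h₁J⟩, rfl⟩, ⟨ω₂, ⟨h₂U, h₂J⟩, rfl⟩, hd, -, hv⟩ := h
  have hF := ghzMatrix_transpose_mul_self hn
  have hF' := ghzMatrix_mul_transpose hn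
  have hS := ghzMatrix_transpose_mul_flipMatrix_mul hn
  have hFU := ghzMatrix_mem_unitaryGroup hn
  set F := ghzMatrix n
  set D := repeatDiagonal d with hD
  obtain ⟨G, hG⟩ : ∃ G, G = ω₂ * Fᵀ := ⟨_, rfl⟩
  have hGU : G ∈ unitaryGroup (Fin (2 ^ n)) ℂ := by
    rw [hG]
    exact mul_mem (mem_specialUnitaryGroup_iff.1 h₂U).1 (mem_unitaryGroup_transpose hFU)
  have hSG : flipMatrix n = -(Gᵀ * symplecticJ (2 ^ n) * G) := calc
    flipMatrix n = F * (Fᵀ * flipMatrix n * F) * Fᵀ := by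
      simp only [Matrix.mul_assoc, hF', Matrix.mul_one]
      rw [← Matrix.mul_assoc, hF', Matrix.one_mul]
    _ = -(F * (ω₂ᵀ * symplecticJ (2 ^ n) * ω₂) * Fᵀ) := by
      rw [hS, h₂J, mul_neg, neg_mul]
    _ = _ := by
      rw [hG, transpose_mul, transpose_transpose]
      simp only [Matrix.mul_assoc]
  have hvG : v = F * ω₁ * D * G := by
    rw [hv, hG, show F * ω₁ * Fᵀ * (F * D * Fᵀ) * (F * ω₂ * Fᵀ) =
      F * ω₁ * (Fᵀ * F) * D * (Fᵀ * F) * ω₂ * Fᵀ by simp only [Matrix.mul_assoc], hF]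
    simp only [Matrix.mul_one, Matrix.mul_assoc]
  have hDt : Dᵀ = D := by rw [hD, repeatDiagonal_eq hN, diagonal_transpose]
  have hvS : vᵀ * flipMatrix n * v = -(Gᵀ * (D * symplecticJ (2 ^ n) * D) * G) := calc
    vᵀ * flipMatrix n * v = Gᵀ * (D * (ω₁ᵀ * (Fᵀ * flipMatrix n * F) * ω₁) * D) * G := by
      rw [hvG]
      simp only [transpose_mul, hDt, Matrix.mul_assoc]
    _ = _ := by
      rw [hS, mul_neg, neg_mul, h₁J]
      simp
  have hC : ∀ φ ψ, concurrenceForm n φ ψ =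
      -((G *ᵥ φ) ⬝ᵥ symplecticJ (2 ^ n) *ᵥ (G *ᵥ ψ)) := fun φ ψ => by
    rw [concurrenceForm_eq, hSG, neg_mulVec, dotProduct_neg, Matrix.mul_assoc, ← mulVec_mulVec,
      dotProduct_mulVec, vecMul_transpose, ← mulVec_mulVec]
  have hvC : ∀ φ ψ, ‖concurrenceForm n (v *ᵥ φ) (v *ᵥ ψ)‖ =
      ‖∑ j : Fin (2 ^ n / 2), d j ^ 2 * ((G *ᵥ φ) (hi j) * (G *ᵥ ψ) (lo j) -
        (G *ᵥ φ) (lo j) * (G *ᵥ ψ) (hi j))‖ := fun φ ψ => by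
    have h1 : concurrenceForm n (v *ᵥ φ) (v *ᵥ ψ) =
        -((D *ᵥ (G *ᵥ φ)) ⬝ᵥ symplecticJ (2 ^ n) *ᵥ (D *ᵥ (G *ᵥ ψ))) := by
      rw [concurrenceForm_eq, ← vecMul_transpose v, ← dotProduct_mulVec, mulVec_mulVec,
        mulVec_mulVec, hvS, neg_mulVec, dotProduct_neg]
      conv_rhs => rw [← vecMul_transpose D, hDt, ← dotProduct_mulVec, ← vecMul_transpose G,
        ← dotProduct_mulVec]
      simp only [mulVec_mulVec, Matrix.mul_assoc]
    rw [h1, norm_neg, dotProduct_symplecticJ_mulVec hN, hD, repeatDiagonal_eq hN]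
    congr 1
    refine Finset.sum_congr rfl fun j _ => ?_
    simp only [mulVec_diagonal, halves_lo, halves_hi]
    ring
  ext c
  constructor
  · rintro ⟨φ, ψ, hφ, hψ, h0, rfl⟩
    refine ⟨G *ᵥ φ, G *ᵥ ψ, ?_, ?_, ?_, hvC φ ψ⟩
    · rwa [hC, neg_eq_zero] at h0
    · rwa [unitary_mulVec_dotProduct hGU]
    · rwa [unitary_mulVec_dotProduct hGU]
  · rintro ⟨z₁, z₂, h0, hz₁, hz₂, rfl⟩
    have hGG : ∀ z, G *ᵥ (Gᴴ *ᵥ z) = z := fun z => by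
      rw [mulVec_mulVec, show G * Gᴴ = 1 from mem_unitaryGroup_iff.1 hGU, one_mulVec]
    have hGH := conjTranspose_mem_unitaryGroup hGU
    refine ⟨Gᴴ *ᵥ z₁, Gᴴ *ᵥ z₂, ?_, ?_, ?_, ?_⟩
    · rwa [unitary_mulVec_dotProduct hGH]
    · rwa [unitary_mulVec_dotProduct hGH]
    · rw [hC, hGG, hGG, h0, neg_zero]
    · rw [hvC, hGG, hGG]

lemma IsOddCCD.norm_sq_eq_one (hn : Odd n) {v k₁ k₂ : Matrix (Fin (2 ^ n)) (Fin (2 ^ n)) ℂ}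
    {d : Fin (2 ^ n / 2) → ℂ} (h : IsOddCCD n v k₁ d k₂) (j : Fin (2 ^ n / 2)) :
    ‖d j ^ 2‖ = 1 := by
  have hU := (mem_specialUnitaryGroup_iff.1 h.2.2.1).1
  rw [repeatDiagonal_eq (even_two_pow hn)] at hU
  have h := congrFun (congrFun (mem_unitaryGroup_iff'.1 hU) (lo j)) (lo j)
  simp only [star_eq_conjTranspose, diagonal_conjTranspose, diagonal_mul_diagonal,
    diagonal_apply_eq, Pi.star_apply, halves_lo, Matrix.one_apply_eq, Complex.star_def,
    Complex.conj_mul'] at h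
  rw [norm_pow]
  exact_mod_cast h

end QubitConcurrence

open QubitConcurrence
theorem mainTheorem1 (n : ℕ) (hn : Odd n) (v : Matrix (Fin (2 ^ n)) (Fin (2 ^ n)) ℂ)
    (hv : v ∈ Matrix.specialUnitaryGroup (Fin (2 ^ n)) ℂ) :
    (∃ lam : Fin (2 ^ n / 2) → ℂ, IsReducedConcurrenceSpectrum n v lam) ∧
    IsGreatest (capacityValues n v) (pairwiseCapacity n v) ∧
    ∀ lam : Fin (2 ^ n / 2) → ℂ, IsReducedConcurrenceSpectrum n v lam →
      IsGreatest
        {c : ℝ | ∃ z₁ z₂ : Fin (2 ^ n) → ℂ,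
          z₁ ⬝ᵥ (symplecticJ (2 ^ n) *ᵥ z₂) = 0 ∧ star z₁ ⬝ᵥ z₁ = 1 ∧ star z₂ ⬝ᵥ z₂ = 1 ∧
          c = ‖∑ j : Fin (2 ^ n / 2), lam j * (z₁ (hi j) * z₂ (lo j) - z₁ (lo j) * z₂ (hi j))‖}
        (pairwiseCapacity n v) ∧
      (pairwiseCapacity n v = 1 ↔ (0 : ℂ) ∈ convexHull ℝ (Set.range lam)) := by
  have hmax := isGreatest_pairwiseCapacity hn v
  refine ⟨?_, hmax, ?_⟩
  · obtain ⟨k₁, d, k₂, h⟩ := exists_isOddCCD hn hv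
    exact ⟨_, k₁, d, k₂, h, fun j => rfl⟩
  · rintro lam ⟨k₁, d, k₂, h, hlam⟩
    obtain rfl : lam = fun j => d j ^ 2 := funext hlam
    have hnorm := h.norm_sq_eq_one hn
    rw [capacityValues_eq_canonicalValues hn h] at hmax
    refine ⟨hmax, ?_⟩
    rw [← one_mem_canonicalValues_iff (even_two_pow hn) hnorm]
    refine ⟨fun h1 => h1 ▸ hmax.1, fun h1 => ?_⟩
    exact le_antisymm (canonicalValues_le_one (even_two_pow hn) hnorm hmax.1) (hmax.2 h1)
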